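/- Let $d\ge 3$, $R\ge 2$, $n_1,\dots,n_d$ be positive integers and $t\in\{1,2\}$. For $\sigma\in\mathbb R^R$ and real matrices $U_j=[\mathbf u_{j,1},\dots,\mathbf u_{j,R}]\in\mathbb R^{n_j\times R}$, $1\le j\le d$, write $$\llbracket\sigma;U_1,\dots,U_d\rrbracket=\sum_{i=1}^R\sigma_i\,\mathbf u_{1,i}\otimes\cdots\otimes\mathbf u_{d,i}\in\mathbb R^{n_1\times\cdots\times n_d}.$$ Call $(\sigma,U)$ feasible if $\|\mathbf u_{j,i}\|=1$ for all $i$ and $1\le j\le d-t$, and $U_j^\top U_j=I$ for $d-t+1\le j\le d$. The decomposition $\mathcal A=\llbracket\sigma;U_1,\dots,U_d\rrbracket$ is called unique if (a) whenever $\mathcal A=\llbracket\sigma';U'_1,\dots,U'_d\rrbracket$ with arbitrary $\sigma'\in\mathbb R^R$, $U'_j\in\mathbb R^{n_j\times R}$, there is a permutation $\pi$ of $\{1,\dots,R\}$ with $\sigma'_{\pi(i)}\,\mathbf u'_{1,\pi(i)}\otimes\cdots\otimes\mathbf u'_{d,\pi(i)}=\sigma_i\,\mathbf u_{1,i}\otimes\cdots\otimes\mathbf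 u_{d,i}$ for all $i$; and (b) a pair $(\sigma',U')$ minimizes $\frac12\|\mathcal A-\llbracket\sigma';U'_1,\dots,U'_d\rrbracket\|_F^2$ over all feasible pairs if and only if it is feasible and there are a permutation $\pi$ and scalars $c_{j,i}$ with $\mathbf u'_{j,\pi(i)}=c_{j,i}\mathbf u_{j,i}$ and $\sigma'_{\pi(i)}\prod_{j=1}^d c_{j,i}=\sigma_i$ for all $i,j$ (so the $c_{j,i}$ are signs if the $\mathbf u_{j,i}$ are unit vectors). Assume $n_j\ge 2$ for $1\le j\le d-t$, and that one of the following holds: 1. $t=1$ and $d\ge R+1$; 2. $t=2$ and $d\ge 5$; 3. $t\in\{1,2\}$ and $n_j\ge R$ for $1\le j\le d-t$. Then the decomposition is generically unique: if the entries of $U_1,\dots,U_{d-t}$ are drawn from a joint probability distribution that is absolutely continuous with respect to Lebesgue measure, then with probability one, for all $\sigma$ with $\sigma_1,\dots,\sigma_R\ne0$ and all $U_j\in\mathbb R^{n_j\times R}$, $d-t+1\le j\le d$, with $U_j^\top U_j=I$, the decomposition $\llbracket\sigma;U_1,\dots,U_d\rrbracket$ is unique. -/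

import Mathlib

open MeasureTheory

namespace OrthCPD

/-- Real tensors of order `d` and format `n 0 × ⋯ × n (d-1)`. -/
abbrev Tensor {d : ℕ} (n : Fin d → ℕ) : Type := ((j : Fin d) → Fin (n j)) → ℝ

/-- Tuples of `d` factor matrices; the `i`-th column of the `j`-th matrix `U j` is the vector
`u_{j,i}`. -/
abbrev Factors {d : ℕ} (n : Fin d → ℕ) (R : ℕ) : Type :=
  (j : Fin d) → Matrix (Fin (n j)) (Fin R) ℝ

/-- The factors `0, …, d-t-1` are the non-orthogonal ones, the last `t` are the columnwise
orthonormal ones. -/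
abbrev NonOrth {d : ℕ} (t : ℕ) (j : Fin d) : Prop := (j : ℕ) + t < d

/-- The `i`-th term `σ_i • u_{1,i} ⊗ ⋯ ⊗ u_{d,i}`. -/
def term {d : ℕ} {n : Fin d → ℕ} {R : ℕ} (σ : Fin R → ℝ) (U : Factors n R) (i : Fin R) :
    Tensor n :=
  fun x => σ i * ∏ j, U j (x j) i

/-- The tensor `⟦σ; U_1, …, U_d⟧ = ∑ i, σ_i • u_{1,i} ⊗ ⋯ ⊗ u_{d,i}`. -/
def cpd {d : ℕ} {n : Fin d → ℕ} {R : ℕ} (σ : Fin R → ℝ) (U : Factors n R) : Tensor n :=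
  ∑ i, term σ U i

/-- The objective function: half the squared Frobenius distance from `A` to `⟦σ; U_1, …, U_d⟧`. -/
noncomputable def objective {d : ℕ} {n : Fin d → ℕ} {R : ℕ} (A : Tensor n) (σ : Fin R → ℝ)
    (U : Factors n R) : ℝ :=
  (1 / 2 : ℝ) * ∑ x, (A x - cpd σ U x) ^ 2

/-- The constraints: unit columns in the first `d-t` factors, orthonormal columns in the last `t`. -/
def Feasible {d : ℕ} {n : Fin d → ℕ} {R : ℕ} (t : ℕ) (U : Factors n R) : Prop :=
  (∀ j, NonOrth t j → ∀ i, ∑ k, U j k i ^ 2 = 1) ∧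
    ∀ j, ¬ NonOrth t j → (U j).transpose * U j = 1

/-- `(σ, U)` is a (global) solution of the problem of minimizing the objective function for `A`
under the constraints. -/
def IsSolution {d : ℕ} {n : Fin d → ℕ} {R : ℕ} (t : ℕ) (A : Tensor n) (σ : Fin R → ℝ)
    (U : Factors n R) : Prop :=
  Feasible t U ∧ ∀ (σ' : Fin R → ℝ) (U' : Factors n R), Feasible t U' →
    objective A σ U ≤ objective A σ' U'

/-- `(σ', U')` arises from `(σ, U)` by a permutation of the terms and by rescaling the vectors
within each term by scalars that `σ` compensates (if all the vectors are normalized, the scalars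
are signs). -/
def EqUpToPermScaling {d : ℕ} {n : Fin d → ℕ} {R : ℕ} (σ : Fin R → ℝ) (U : Factors n R)
    (σ' : Fin R → ℝ) (U' : Factors n R) : Prop :=
  ∃ (π : Equiv.Perm (Fin R)) (c : Fin d → Fin R → ℝ),
    (∀ j k i, U' j k (π i) = c j i * U j k i) ∧ ∀ i, σ' (π i) * ∏ j, c j i = σ i

/-- Uniqueness of the decomposition `A = ⟦σ; U_1, …, U_d⟧`: it is the only way to write `A` as a
combination of `R` rank-one terms, up to the order of the terms (the competing terms are not
required to satisfy the constraints); and, after normalization of the columns, `(σ, U)` is, up to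
permutation and signs, the only solution of the constrained minimization problem for `A`. -/
structure IsUniqueDecomposition {d : ℕ} {n : Fin d → ℕ} {R : ℕ} (t : ℕ) (σ : Fin R → ℝ)
    (U : Factors n R) : Prop where
  terms : ∀ (σ' : Fin R → ℝ) (U' : Factors n R), cpd σ' U' = cpd σ U →
    ∃ π : Equiv.Perm (Fin R), ∀ i, term σ' U' (π i) = term σ U i
  solutions : ∀ (σ' : Fin R → ℝ) (U' : Factors n R),
    IsSolution t (cpd σ U) σ' U' ↔ Feasible t U' ∧ EqUpToPermScaling σ U σ' U'

/-- The space of all the entries of the non-orthogonal factor matrices, a finite-dimensional real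
coordinate space with its Lebesgue measure `volume`. -/
abbrev NonOrthEntries {d : ℕ} (n : Fin d → ℕ) (R t : ℕ) : Type :=
  (j : {j : Fin d // NonOrth t j}) → Fin (n j) → Fin R → ℝ

end OrthCPD

/-!
All the cases reduce to simultaneous diagonalization of a tensor of order three (Jennrich's
argument). The modes are grouped into three: the first one, `c`, the last one, `b`, and all those in
between, `a`. The tensor becomes `∑ i, a_i ⊗ b_i ⊗ c_i`, where the weight `σ_i` is put into `c_i`.

* The `b_i` are orthonormal. Almost surely no two of the `c_i` are proportional, because the `2 × 2`
  minors of the first factor matrix do not vanish.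
* The `a_i`, products of columns of the middle factors, are linearly independent. In each of the
  cases there is, for every `i`, a product of functionals on the middle modes that is nonzero at
  `a_i` and zero at all the other `a_k`: either a single middle factor has linearly independent
  columns (it is orthonormal when `t = 2`, or it is a random matrix with at least `R` rows), or there
  are at least `R - 1` middle factors with pairwise independent columns, and each of the `R - 1`
  indices `k ≠ i` is given a mode of its own whose functional kills the `k`-th column
  (`exists_separating_weights_of_mul_eq_one`, `exists_separating_weights_of_pairwise`,
  `exists_mul_prod_eq_one`).

Let `∑ i, a'_i ⊗ b'_i ⊗ c'_i` be another decomposition of the same tensor. Contraction with the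
functionals dual to the `a_i` and `b_i` turns the equality into `P * D'_z * S = D_z` for every
coordinate `z` of the `c` mode, with square matrices `P`, `S` that do not depend on `z` and with
`D_z`, `D'_z` the diagonal matrices of the `z`-th coordinates of the `c_i` and `c'_i`. A generic
combination of these equations is invertible, and a second one makes the quotients of the diagonal
entries distinct; hence `P` and `S` are permutation matrices up to scaling, and the terms agree
(`exists_perm_of_mul_eq_one`).

The minimum of the objective function is `0`, because normalizing the columns of `U` makes the
decomposition feasible. So the solutions are the feasible exact decompositions, and uniqueness of the
terms determines them (`isUniqueDecomposition_of_terms`).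

The minors do not vanish almost surely since, on every line in the direction that adds multiples of
the identity to the submatrix, its determinant is the value of a characteristic polynomial
(`ae_det_submatrix_ne_zero`).
-/

namespace OrthCPD

open Matrix

/-! ### Uniqueness of decompositions of tensors of order three -/

/-- Jennrich's theorem: if the columns of `a` and `b` are linearly independent (`α` and `β` are left
inverses) and those of `c` are nonzero and pairwise independent, the rank-one terms of
`∑ i, a_i ⊗ b_i ⊗ c_i` are determined by the sum. Nothing is assumed about the other
decomposition. -/
theorem exists_perm_of_mul_eq_one {ι X Y Z : Type*} [Fintype ι] [DecidableEq ι] [Fintype X]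
    [Fintype Y] [Fintype Z] {a a' : Matrix X ι ℝ} {b b' : Matrix Y ι ℝ} {c c' : Matrix Z ι ℝ}
    {α : Matrix ι X ℝ} {β : Matrix ι Y ℝ} (hα : α * a = 1) (hβ : β * b = 1)
    (hc0 : ∀ i, ∃ z, c z i ≠ 0)
    (hc : ∀ i k, i ≠ k → ∃ z w, c z i * c w k ≠ c w i * c z k)
    (h : ∀ x y z, ∑ i, a' x i * b' y i * c' z i = ∑ i, a x i * b y i * c z i) :
    ∃ π : Equiv.Perm ι, ∀ i x y z,
      a' x (π i) * b' y (π i) * c' z (π i) = a x i * b y i * c z i := by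
  have hslice : ∀ z, a' * diagonal (c' z) * b'ᵀ = a * diagonal (c z) * bᵀ := by
    intro z
    ext x y
    rw [mul_apply, mul_apply]
    simp only [mul_diagonal, transpose_apply]
    convert! h x y z using 2 <;> ring
  have hβ' : bᵀ * βᵀ = 1 := by rw [← transpose_mul, hβ, transpose_one]
  set P := α * a' with hP
  set S := b'ᵀ * βᵀ with hS
  have hα1 : ∀ z, P * diagonal (c' z) * b'ᵀ = diagonal (c z) * bᵀ := fun z => by
    calc P * diagonal (c' z) * b'ᵀ = α * (a' * diagonal (c' z) * b'ᵀ) := by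
          simp only [hP, Matrix.mul_assoc]
      _ = (α * a) * (diagonal (c z) * bᵀ) := by rw [hslice]; simp only [Matrix.mul_assoc]
      _ = _ := by rw [hα, Matrix.one_mul]
  have hβ1 : ∀ z, a' * diagonal (c' z) * S = a * diagonal (c z) := fun z => by
    calc a' * diagonal (c' z) * S = (a' * diagonal (c' z) * b'ᵀ) * βᵀ := by
          simp only [hS, Matrix.mul_assoc]
      _ = a * diagonal (c z) * (bᵀ * βᵀ) := by rw [hslice]; simp only [Matrix.mul_assoc]
      _ = _ := by rw [hβ', Matrix.mul_one]
  have hPS : ∀ z, P * diagonal (c' z) * S = diagonal (c z) := fun z => by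
    calc P * diagonal (c' z) * S = (P * diagonal (c' z) * b'ᵀ) * βᵀ := by
          simp only [hS, Matrix.mul_assoc]
      _ = diagonal (c z) * (bᵀ * βᵀ) := by rw [hα1, Matrix.mul_assoc]
      _ = _ := by rw [hβ', Matrix.mul_one]
  have hPSw : ∀ w : Z → ℝ, P * diagonal (w ᵥ* c') * S = diagonal (w ᵥ* c) := by
    intro w
    have hd : ∀ e : Matrix Z ι ℝ, diagonal (w ᵥ* e) = ∑ z, w z • diagonal (e z) := by
      intro e
      ext i j
      rw [Matrix.sum_apply]
      by_cases hij : i = j <;> simp [hij, vecMul, dotProduct]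
    rw [hd, hd, Matrix.mul_sum, Matrix.sum_mul]
    exact Finset.sum_congr rfl fun z _ => by
      rw [Matrix.mul_smul, Matrix.smul_mul, hPS]
  -- `u` makes the diagonal matrix invertible; `v` makes the quotients of its own diagonal entries by
  -- those of `u` distinct. Both avoid finitely many hyperplanes.
  obtain ⟨u, hu⟩ : ∃ u : Z → ℝ, ∀ i, (u ᵥ* c) i ≠ 0 := by
    obtain ⟨u, hu⟩ := Module.Dual.exists_forall_ne_zero_of_forall_exists (K := ℝ)
      (fun i => (LinearMap.proj i).comp c.vecMulLinear) (fun i => by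
        obtain ⟨z, hz⟩ := hc0 i
        classical
        exact ⟨Pi.single z 1, by simpa using hz⟩)
    exact ⟨u, fun i => by simpa using hu i⟩
  obtain ⟨v, hv⟩ : ∃ v : Z → ℝ, ∀ i k, i ≠ k →
      (u ᵥ* c) k * (v ᵥ* c) i - (u ᵥ* c) i * (v ᵥ* c) k ≠ 0 := by
    obtain ⟨v, hv⟩ := Module.Dual.exists_forall_ne_zero_of_forall_exists (K := ℝ)
      (fun p : {p : ι × ι // p.1 ≠ p.2} =>
        (u ᵥ* c) p.1.2 • (LinearMap.proj p.1.1).comp c.vecMulLinear -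
        (u ᵥ* c) p.1.1 • (LinearMap.proj p.1.2).comp c.vecMulLinear) (fun p => by
        classical
        by_contra! hall
        obtain ⟨z, w, hzw⟩ := hc p.1.1 p.1.2 p.2
        have h1 := hall (Pi.single z 1)
        have h2 := hall (Pi.single w 1)
        simp only [LinearMap.sub_apply, LinearMap.smul_apply, LinearMap.comp_apply,
          LinearMap.proj_apply, Matrix.vecMulLinear_apply, single_one_vecMul, smul_eq_mul,
          row_apply] at h1 h2
        apply hzw
        apply mul_left_cancel₀ (hu p.1.2)
        linear_combination c w p.1.2 * h1 - c z p.1.2 * h2)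
    exact ⟨v, fun i k hik => by simpa using hv ⟨(i, k), hik⟩⟩
  have hdet : IsUnit (P * diagonal (u ᵥ* c') * S).det := by
    rw [hPSw, det_diagonal]
    exact (Finset.prod_ne_zero_iff.2 fun i _ => hu i).isUnit
  have hSu : IsUnit S.det := by
    rw [det_mul] at hdet
    exact isUnit_of_mul_isUnit_right hdet
  have hcu : ∀ k, (u ᵥ* c') k ≠ 0 := by
    have : (P * diagonal (u ᵥ* c') * S).det ≠ 0 := hdet.ne_zero
    rw [det_mul, det_mul, det_diagonal] at this
    intro k
    exact Finset.prod_ne_zero_iff.1 (right_ne_zero_of_mul (left_ne_zero_of_mul this)) k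
      (Finset.mem_univ k)
  have hentry : ∀ (w : Z → ℝ) i k, P i k * (w ᵥ* c') k = (w ᵥ* c) i * S⁻¹ i k := by
    intro w i k
    have : P * diagonal (w ᵥ* c') = diagonal (w ᵥ* c) * S⁻¹ := by
      rw [← hPSw, Matrix.mul_nonsing_inv_cancel_right _ _ hSu]
    simpa [mul_diagonal, diagonal_mul] using congrFun (congrFun this i) k
  -- A nonzero entry `P i k` makes the `i`-th quotient of the `c`-side equal to the `k`-th quotient of
  -- the `c'`-side, so every column of `P` has at most one nonzero entry.
  have hratio : ∀ i k, P i k ≠ 0 → (v ᵥ* c') k * (u ᵥ* c) i = (u ᵥ* c') k * (v ᵥ* c) i := by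
    intro i k hik
    apply mul_left_cancel₀ hik
    linear_combination (u ᵥ* c) i * hentry v i k - (v ᵥ* c) i * hentry u i k
  have huniq : ∀ i j k, P i k ≠ 0 → P j k ≠ 0 → i = j := by
    intro i j k hi hj
    by_contra hij
    apply hv i j hij
    apply mul_left_cancel₀ (hcu k)
    linear_combination (u ᵥ* c) i * hratio j k hj - (u ᵥ* c) j * hratio i k hi
  have hex : ∀ i, ∃ k, P i k ≠ 0 := by
    intro i
    by_contra! hall
    have := congrFun (congrFun (hPSw u) i) i
    rw [Matrix.mul_assoc, mul_apply, diagonal_apply_eq] at this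
    exact hu i (by rw [← this]; simp [hall])
  choose f hf using hex
  have hfinj : Function.Injective f := fun i j hij =>
    huniq i j (f i) (hf i) (hij ▸ hf j)
  let π : Equiv.Perm ι := Equiv.ofBijective f (Finite.injective_iff_bijective.1 hfinj)
  have hπ : ∀ i, P i (π i) ≠ 0 := hf
  have hP0 : ∀ i k, k ≠ π i → P i k = 0 := by
    intro i k hk
    obtain ⟨j, rfl⟩ := π.surjective k
    by_contra hne
    exact hk (congrArg π (huniq j i (π j) (hπ j) hne))
  have hrow : ∀ (w : ι → ℝ) i z, ∑ k, (P * diagonal (c' z)) i k * w k =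
      P i (π i) * c' z (π i) * w (π i) := by
    intro w i z
    rw [Finset.sum_eq_single (π i)]
    · rw [mul_diagonal]
    · intro k _ hk
      rw [mul_diagonal, hP0 i k hk, zero_mul, zero_mul]
    · simp
  have hcz : ∀ i z, P i (π i) * c' z (π i) * S (π i) i = c z i := by
    intro i z
    rw [← hrow (fun k => S k i), ← mul_apply, hPS, diagonal_apply_eq]
  have hc'0 : ∀ i, ∃ z, c' z (π i) ≠ 0 ∧ S (π i) i ≠ 0 := by
    intro i
    obtain ⟨z, hz⟩ := hc0 i
    rw [← hcz] at hz
    exact ⟨z, right_ne_zero_of_mul (left_ne_zero_of_mul hz), right_ne_zero_of_mul hz⟩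
  -- `S` has the zero pattern of the transpose of `P`.
  have hS0 : ∀ i k, k ≠ π i → S k i = 0 := by
    intro i k hk
    obtain ⟨j, rfl⟩ := π.surjective k
    obtain ⟨z, hz, -⟩ := hc'0 j
    have := hrow (fun k => S k i) j z
    rw [← mul_apply, hPS, diagonal_apply_ne _ (fun hji => hk (congrArg π hji))] at this
    exact (mul_eq_zero.1 this.symm).resolve_left (mul_ne_zero (hπ j) hz)
  have hb : ∀ i y, b' y (π i) = b y i * S (π i) i := by
    intro i y
    obtain ⟨z, hz, hs⟩ := hc'0 i
    have := hrow (fun k => b'ᵀ k y) i z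
    rw [← mul_apply, hα1, diagonal_mul, transpose_apply, transpose_apply, ← hcz] at this
    apply mul_left_cancel₀ (mul_ne_zero (hπ i) hz)
    linear_combination -this
  have ha : ∀ i x, a' x (π i) = a x i * P i (π i) := by
    intro i x
    obtain ⟨z, hz, hs⟩ := hc'0 i
    have := congrFun (congrFun (hβ1 z) x) i
    rw [mul_apply, Finset.sum_eq_single (π i) (fun k _ hk => by rw [hS0 i k hk, mul_zero])
      (by simp), mul_diagonal, mul_diagonal, ← hcz] at this
    apply mul_left_cancel₀ (mul_ne_zero hz hs)
    linear_combination this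
  refine ⟨π, fun i x y z => ?_⟩
  rw [ha, hb, ← hcz]
  ring

/-! ### Grouping the modes -/

/-- Columnwise products of matrices (Khatri–Rao products) have a left inverse if, for each `i`, some
product of functionals does not vanish at the `i`-th column but vanishes at all the others. -/
theorem exists_mul_prod_eq_one {d R : ℕ} {n : Fin d → ℕ} (V : Factors n R)
    (hV : ∀ i, ∃ φ : (j : Fin d) → Fin (n j) → ℝ, (∀ j, ∑ p, φ j p * V j p i ≠ 0) ∧
      ∀ k, k ≠ i → ∃ j, ∑ p, φ j p * V j p k = 0) :
    ∃ α : Matrix (Fin R) ((j : Fin d) → Fin (n j)) ℝ,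
      α * Matrix.of (fun (x : (j : Fin d) → Fin (n j)) i => ∏ j, V j (x j) i) = 1 := by
  choose φ hφ hφ0 using hV
  refine ⟨Matrix.of fun i x => (∏ j, ∑ p, φ i j p * V j p i)⁻¹ * ∏ j, φ i j (x j), ?_⟩
  ext i k
  have hsum : ∑ x : (j : Fin d) → Fin (n j), ∏ j, φ i j (x j) * V j (x j) k =
      ∏ j, ∑ p, φ i j p * V j p k := by
    rw [Finset.prod_univ_sum, Fintype.piFinset_univ]
  rw [mul_apply]
  simp only [of_apply, mul_assoc, ← Finset.mul_sum, ← Finset.prod_mul_distrib]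
  rw [hsum]
  by_cases hik : k = i
  · subst hik
    rw [one_apply_eq, inv_mul_cancel₀ (Finset.prod_ne_zero_iff.2 fun j _ => hφ k j)]
  · obtain ⟨j, hj⟩ := hφ0 i k hik
    have hzero : ∏ j, ∑ p, φ i j p * V j p k = 0 := Finset.prod_eq_zero (Finset.mem_univ j) hj
    rw [one_apply_ne (Ne.symm hik), hzero, mul_zero]

theorem prod_update_update {d R : ℕ} {n : Fin d → ℕ} (U : Factors n R) {c b : Fin d} (hcb : c ≠ b)
    (x : (j : Fin d) → Fin (n j)) (z : Fin (n c)) (y : Fin (n b)) (i : Fin R) :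
    ∏ j, U j (Function.update (Function.update x c z) b y j) i =
      (∏ j, if j = c ∨ j = b then 1 else U j (x j) i) * U b y i * U c z i := by
  have hfac : ∀ j, U j (Function.update (Function.update x c z) b y j) i =
      (if j = c ∨ j = b then 1 else U j (x j) i) * (if j = b then U b y i else 1) *
        (if j = c then U c z i else 1) := by
    intro j
    by_cases hb : j = b
    · subst hb
      simp [Ne.symm hcb]
    · by_cases hc : j = c
      · subst hc
        simp [hb]
      · simp [hb, hc]
  rw [Finset.prod_congr rfl fun j _ => hfac j, Finset.prod_mul_distrib, Finset.prod_mul_distrib]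
  simp

/-- Uniqueness of the terms of a tensor of order `d`, grouped into the modes `c`, `b` and the rest. -/
theorem exists_perm_term_eq {d R : ℕ} {n : Fin d → ℕ} {σ : Fin R → ℝ} {U : Factors n R}
    (hσ : ∀ i, σ i ≠ 0) {c b : Fin d} (hcb : c ≠ b) [NeZero (n c)] [NeZero (n b)]
    (hc0 : ∀ i, ∃ z, U c z i ≠ 0)
    (hc : ∀ i k, i ≠ k → ∃ z w, U c z i * U c w k ≠ U c w i * U c z k)
    {β : Matrix (Fin R) (Fin (n b)) ℝ} (hβ : β * U b = 1)
    (hU : ∀ i, ∃ φ : (j : Fin d) → Fin (n j) → ℝ,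
      (∀ j, j ≠ c → j ≠ b → ∑ p, φ j p * U j p i ≠ 0) ∧
      ∀ k, k ≠ i → ∃ j, j ≠ c ∧ j ≠ b ∧ ∑ p, φ j p * U j p k = 0)
    {σ' : Fin R → ℝ} {U' : Factors n R} (h : cpd σ' U' = cpd σ U) :
    ∃ π : Equiv.Perm (Fin R), ∀ i, term σ' U' (π i) = term σ U i := by
  -- The grouped mode is indexed by all of `x`: the columns are extended to the modes `c` and `b` by
  -- the constant `1`, and these two coordinates of `x` are overwritten by `z` and `y`.
  obtain ⟨α, hα⟩ := exists_mul_prod_eq_one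
    (fun j => if j = c ∨ j = b then Matrix.of fun _ _ => 1 else U j) (fun i => by
      obtain ⟨φ, hφ, hφ0⟩ := hU i
      refine ⟨fun j => if j = c ∨ j = b then 1 else φ j, fun j => ?_, fun k hk => ?_⟩
      · by_cases hj : j = c ∨ j = b
        · rcases hj with rfl | rfl <;> simp [NeZero.ne]
        · simp only [hj, if_false]
          push Not at hj
          exact hφ j hj.1 hj.2
      · obtain ⟨j, hjc, hjb, hj⟩ := hφ0 k hk
        exact ⟨j, by simpa [hjc, hjb] using hj⟩)
  have hval : ∀ (τ : Fin R → ℝ) (V : Factors n R) (x : (j : Fin d) → Fin (n j)) z y i,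
      term τ V i (Function.update (Function.update x c z) b y) =
        (Matrix.of fun x i => ∏ j, if j = c ∨ j = b then 1 else V j (x j) i) x i * V b y i *
          (Matrix.of fun z i => τ i * V c z i) z i := by
    intro τ V x z y i
    rw [term, prod_update_update V hcb]
    simp only [of_apply]
    ring
  obtain ⟨π, hπ⟩ := exists_perm_of_mul_eq_one (α := α) (β := β)
    (a := Matrix.of fun x i => ∏ j, if j = c ∨ j = b then 1 else U j (x j) i)
    (a' := Matrix.of fun x i => ∏ j, if j = c ∨ j = b then 1 else U' j (x j) i)
    (b := U b) (b' := U' b) (c := Matrix.of fun z i => σ i * U c z i)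
    (c' := Matrix.of fun z i => σ' i * U' c z i)
    (by
      rw [← hα]
      congr 2
      ext x i
      refine Finset.prod_congr rfl fun j _ => ?_
      split_ifs <;> rfl)
    hβ
    (fun i => (hc0 i).imp fun z hz => mul_ne_zero (hσ i) hz)
    (fun i k hik => by
      obtain ⟨z, w, hzw⟩ := hc i k hik
      refine ⟨z, w, fun heq => hzw (mul_left_cancel₀ (mul_ne_zero (hσ i) (hσ k)) ?_)⟩
      simp only [of_apply] at heq
      linear_combination heq)
    (fun x y z => by
      have := congrFun h (Function.update (Function.update x c z) b y)
      simp only [cpd, Finset.sum_apply, hval] at this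
      exact this)
  refine ⟨π, fun i => funext fun x => ?_⟩
  have := hπ i x (x b) (x c)
  rw [← hval, ← hval] at this
  simpa using this

/-! ### Solutions of the minimization problem -/

theorem objective_nonneg {d R : ℕ} {n : Fin d → ℕ} (A : Tensor n) (σ : Fin R → ℝ)
    (U : Factors n R) : 0 ≤ objective A σ U :=
  mul_nonneg (by norm_num) (Finset.sum_nonneg fun _ _ => sq_nonneg _)

theorem objective_eq_zero_iff {d R : ℕ} {n : Fin d → ℕ} {A : Tensor n} {σ : Fin R → ℝ}
    {U : Factors n R} : objective A σ U = 0 ↔ cpd σ U = A := by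
  rw [objective, mul_eq_zero, or_iff_right (by norm_num),
    Finset.sum_eq_zero_iff_of_nonneg fun _ _ => sq_nonneg _, eq_comm (a := cpd σ U), funext_iff]
  simp only [Finset.mem_univ, true_imp_iff, sq_eq_zero_iff, sub_eq_zero]

/-- Moving the norms of the columns into the weights makes a decomposition feasible. -/
theorem exists_feasible_cpd_eq {d R t : ℕ} {n : Fin d → ℕ} (σ : Fin R → ℝ) (U : Factors n R)
    (h0 : ∀ j i, ∃ p, U j p i ≠ 0) (hU : ∀ j, ¬ NonOrth t j → (U j)ᵀ * U j = 1) :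
    ∃ (σ' : Fin R → ℝ) (U' : Factors n R), Feasible t U' ∧ cpd σ' U' = cpd σ U := by
  classical
  let N : Fin d → Fin R → ℝ := fun j i => if NonOrth t j then √(∑ p, U j p i ^ 2) else 1
  have hpos : ∀ j i, 0 < ∑ p, U j p i ^ 2 := fun j i =>
    Finset.sum_pos' (fun _ _ => sq_nonneg _)
      ((h0 j i).imp fun p hp => ⟨Finset.mem_univ p, by positivity⟩)
  have hN : ∀ j i, N j i ≠ 0 := by
    intro j i
    by_cases hj : NonOrth t j
    · simpa only [N, hj, if_true] using (Real.sqrt_pos.2 (hpos j i)).ne'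
    · simp [N, hj]
  refine ⟨fun i => σ i * ∏ j, N j i, fun j => Matrix.of fun p i => U j p i / N j i,
    ⟨fun j hj i => ?_, fun j hj => ?_⟩, ?_⟩
  · simp only [of_apply, div_pow, ← Finset.sum_div, N, hj, if_true,
      Real.sq_sqrt (hpos j i).le]
    exact div_self (hpos j i).ne'
  · rw [← hU j hj]
    simp only [N, hj, if_false, div_one]
    rfl
  · refine Finset.sum_congr rfl fun i _ => funext fun x => ?_
    simp only [term, of_apply, Finset.prod_div_distrib]
    rw [mul_assoc, mul_div_cancel₀ _ (Finset.prod_ne_zero_iff.2 fun j _ => hN j i)]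

/-- The vectors of a nonzero rank-one tensor are determined up to scaling. -/
theorem eqUpToPermScaling_of_term_eq {d R : ℕ} {n : Fin d → ℕ} {σ σ' : Fin R → ℝ}
    {U U' : Factors n R} (hσ : ∀ i, σ i ≠ 0) (h0 : ∀ j i, ∃ p, U j p i ≠ 0)
    (π : Equiv.Perm (Fin R)) (hπ : ∀ i, term σ' U' (π i) = term σ U i) :
    EqUpToPermScaling σ U σ' U' := by
  choose x hx using fun i j => h0 j i
  have hterm : ∀ i (y : (j : Fin d) → Fin (n j)), σ' (π i) * ∏ j, U' j (y j) (π i) = σ i * ∏ j, U j (y j) i :=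
    fun i y => congrFun (hπ i) y
  refine ⟨π, fun j i => U' j (x i j) (π i) / U j (x i j) i, fun j k i => ?_, fun i => ?_⟩
  · have hprod : ∀ (V : Factors n R) l q, ∏ j', V j' (Function.update (x i) j q j') l =
        V j q l * ∏ j' ∈ Finset.univ.erase j, V j' (x i j') l := by
      intro V l q
      rw [← Finset.mul_prod_erase _ _ (Finset.mem_univ j), Function.update_self]
      congr 1
      exact Finset.prod_congr rfl fun j' hj' => by
        rw [Function.update_of_ne (Finset.ne_of_mem_erase hj')]
    have h1 := hterm i (Function.update (x i) j k)
    have h2 := hterm i (Function.update (x i) j (x i j))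
    rw [hprod, hprod] at h1 h2
    have hne : σ i * ∏ j' ∈ Finset.univ.erase j, U j' (x i j') i ≠ 0 :=
      mul_ne_zero (hσ i) (Finset.prod_ne_zero_iff.2 fun j' _ => hx i j')
    have hne' : σ' (π i) * ∏ j' ∈ Finset.univ.erase j, U' j' (x i j') (π i) ≠ 0 := by
      intro hz
      apply mul_ne_zero hne (hx i j)
      linear_combination -h2 + U' j (x i j) (π i) * hz
    rw [div_mul_eq_mul_div, eq_div_iff (hx i j)]
    apply mul_left_cancel₀ hne'
    linear_combination U j (x i j) i * h1 - U j k i * h2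
  · rw [Finset.prod_div_distrib, ← mul_div_assoc, hterm i (x i)]
    exact mul_div_cancel_right₀ _ (Finset.prod_ne_zero_iff.2 fun j _ => hx i j)

theorem EqUpToPermScaling.cpd_eq {d R : ℕ} {n : Fin d → ℕ} {σ σ' : Fin R → ℝ}
    {U U' : Factors n R} (h : EqUpToPermScaling σ U σ' U') : cpd σ' U' = cpd σ U := by
  obtain ⟨π, c, hU, hσ⟩ := h
  rw [cpd, cpd, ← Equiv.sum_comp π]
  refine Finset.sum_congr rfl fun i _ => funext fun x => ?_
  simp only [term, hU, ← hσ, Finset.prod_mul_distrib]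
  ring

/-- Uniqueness of the terms implies uniqueness of the solution: the minimum is `0`, so every solution
is an exact decomposition. -/
theorem isUniqueDecomposition_of_terms {d R t : ℕ} {n : Fin d → ℕ} {σ : Fin R → ℝ}
    {U : Factors n R} (hσ : ∀ i, σ i ≠ 0) (h0 : ∀ j i, ∃ p, U j p i ≠ 0)
    (hU : ∀ j, ¬ NonOrth t j → (U j)ᵀ * U j = 1)
    (h : ∀ (σ' : Fin R → ℝ) (U' : Factors n R), cpd σ' U' = cpd σ U →
      ∃ π : Equiv.Perm (Fin R), ∀ i, term σ' U' (π i) = term σ U i) :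
    IsUniqueDecomposition t σ U := by
  refine ⟨h, fun σ' U' => ⟨fun hs => ⟨hs.1, ?_⟩, fun ⟨hf, he⟩ => ⟨hf, fun τ V _ => ?_⟩⟩⟩
  · obtain ⟨τ, V, hV, hτ⟩ := exists_feasible_cpd_eq σ U h0 hU
    have hle := hs.2 τ V hV
    rw [objective_eq_zero_iff.2 hτ] at hle
    obtain ⟨π, hπ⟩ := h σ' U' (objective_eq_zero_iff.1 (hle.antisymm (objective_nonneg _ _ _)))
    exact eqUpToPermScaling_of_term_eq hσ h0 π hπ
  · rw [objective_eq_zero_iff.2 he.cpd_eq]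
    exact objective_nonneg _ _ _

/-! ### Genericity -/

/-- The square submatrices of the random factors are almost surely invertible. -/
theorem ae_det_submatrix_ne_zero {d R t : ℕ} {n : Fin d → ℕ} {m : ℕ} (j : {j : Fin d // NonOrth t j})
    (f : Fin m ↪ Fin (n j)) (g : Fin m ↪ Fin R) :
    ∀ᵐ X : NonOrthEntries n R t, ((Matrix.of (X j)).submatrix f g).det ≠ 0 := by
  classical
  -- The direction in which the chosen submatrix moves along the identity matrix.
  let V : NonOrthEntries n R t :=
    Pi.single j fun p i => if ∃ a, f a = p ∧ g a = i then 1 else 0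
  have hV : ∀ a b, V j (f a) (g b) = (1 : Matrix (Fin m) (Fin m) ℝ) a b := by
    intro a b
    simp only [V, Pi.single_eq_same, one_apply]
    congr 1
    simp
  have hcont : Continuous fun X : NonOrthEntries n R t =>
      ((Matrix.of (X j)).submatrix f g).det := by
    refine Continuous.matrix_det (continuous_matrix fun a b => ?_)
    simp only [submatrix_apply, of_apply]
    fun_prop
  have (j : {j : Fin d // NonOrth t j}) :
      (volume : Measure (Fin (n j) → Fin R → ℝ)).IsAddHaarMeasure :=
    Measure.pi.isAddHaarMeasure _
  have : (volume : Measure (NonOrthEntries n R t)).IsAddHaarMeasure :=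
    Measure.pi.isAddHaarMeasure _
  refine ae_mem_of_ae_add_linearMap_mem (LinearMap.toSpanSingleton ℝ _ V) volume volume
    (s := {X | ((Matrix.of (X j)).submatrix f g).det ≠ 0})
    (isOpen_ne_fun hcont continuous_const).measurableSet fun X => ?_
  -- On the line `s ↦ X + s • V` the determinant is the characteristic polynomial of the negative of
  -- the submatrix at `X`, evaluated at `s`, so it has finitely many zeros.
  refine measure_mono_null (t := ((-(Matrix.of (X j)).submatrix f g).charpoly.rootSet ℝ))
    (fun s hs => ?_) (Set.Finite.measure_zero (Polynomial.rootSet_finite _ _) _)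
  rw [Polynomial.mem_rootSet_of_ne (charpoly_monic _).ne_zero, Polynomial.aeval_def,
    Algebra.algebraMap_self, Polynomial.eval₂_id, eval_charpoly]
  have hs' : ((Matrix.of ((X + s • V) j)).submatrix f g).det = 0 := by simpa using hs
  rw [← hs']
  congr 1
  ext a b
  simp only [sub_neg_eq_add, Matrix.add_apply, submatrix_apply, of_apply, Pi.add_apply,
    Pi.smul_apply, smul_eq_mul, hV]
  rw [add_comm, scalar_apply, diagonal_apply, one_apply]
  simp

/-! ### Functionals separating the columns of the middle modes -/

theorem exists_weights_pairwise {N R : ℕ} {M : Matrix (Fin N) (Fin R) ℝ} {i k : Fin R}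
    (h : ∃ z w, M z i * M w k ≠ M w i * M z k) :
    ∃ φ : Fin N → ℝ, ∑ p, φ p * M p i ≠ 0 ∧ ∑ p, φ p * M p k = 0 := by
  obtain ⟨z, w, hzw⟩ := h
  refine ⟨Pi.single z (M w k) - Pi.single w (M z k), ?_, ?_⟩
  · simp only [Pi.sub_apply, sub_mul, Finset.sum_sub_distrib, Pi.single_apply, ite_mul, zero_mul,
      Finset.sum_ite_eq', Finset.mem_univ, if_true]
    intro h0
    apply hzw
    linear_combination h0
  · simp only [Pi.sub_apply, sub_mul, Finset.sum_sub_distrib, Pi.single_apply, ite_mul, zero_mul,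
      Finset.sum_ite_eq', Finset.mem_univ, if_true]
    ring

theorem exists_weights_ne_zero {N R : ℕ} {M : Matrix (Fin N) (Fin R) ℝ} {i : Fin R}
    (h : ∃ z, M z i ≠ 0) : ∃ φ : Fin N → ℝ, ∑ p, φ p * M p i ≠ 0 :=
  h.imp' (fun z => Pi.single z 1) fun z hz => by simpa [Pi.single_apply] using hz

/-- One middle factor with linearly independent columns separates the products by itself. -/
theorem exists_separating_weights_of_mul_eq_one {d R : ℕ} {n : Fin d → ℕ} {U : Factors n R}
    {c b : Fin d} (h0 : ∀ j i, ∃ p, U j p i ≠ 0) {l : Fin d} (hlc : l ≠ c) (hlb : l ≠ b)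
    {W : Matrix (Fin R) (Fin (n l)) ℝ} (hW : W * U l = 1) (i : Fin R) :
    ∃ φ : (j : Fin d) → Fin (n j) → ℝ,
      (∀ j, j ≠ c → j ≠ b → ∑ p, φ j p * U j p i ≠ 0) ∧
      ∀ k, k ≠ i → ∃ j, j ≠ c ∧ j ≠ b ∧ ∑ p, φ j p * U j p k = 0 := by
  choose ψ hψ using fun j => exists_weights_ne_zero (h0 j i)
  have hWl : ∀ k, ∑ p, W i p * U l p k = (1 : Matrix (Fin R) (Fin R) ℝ) i k := fun k => by
    rw [← hW, mul_apply]
  refine ⟨Function.update ψ l (W i), fun j _ _ => ?_, fun k hk => ⟨l, hlc, hlb, ?_⟩⟩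
  · by_cases hj : j = l
    · subst hj
      simp [hWl]
    · simpa [hj] using hψ j
  · simp [hWl, one_apply_ne (Ne.symm hk)]

/-- At least `R - 1` middle factors with pairwise independent columns separate the products: each
`k ≠ i` is assigned to its own middle mode, namely `k + 1` if `k < i` and `k` if `k > i`. -/
theorem exists_separating_weights_of_pairwise {d R : ℕ} {n : Fin d → ℕ} {U : Factors n R}
    {c b : Fin d} (hc : (c : ℕ) = 0) (hb : (b : ℕ) + 1 = d) (hRd : R + 1 ≤ d)
    (h0 : ∀ j i, ∃ p, U j p i ≠ 0)
    (hpair : ∀ j, j ≠ b → ∀ i k, i ≠ k → ∃ z w, U j z i * U j w k ≠ U j w i * U j z k)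
    (i : Fin R) :
    ∃ φ : (j : Fin d) → Fin (n j) → ℝ,
      (∀ j, j ≠ c → j ≠ b → ∑ p, φ j p * U j p i ≠ 0) ∧
      ∀ k, k ≠ i → ∃ j, j ≠ c ∧ j ≠ b ∧ ∑ p, φ j p * U j p k = 0 := by
  have hφ : ∀ j : Fin d, ∃ φ : Fin (n j) → ℝ, ∑ p, φ p * U j p i ≠ 0 ∧
      (j ≠ b → ∀ k, k ≠ i → (j : ℕ) = (if k < i then k + 1 else k : ℕ) →
        ∑ p, φ p * U j p k = 0) := by
    intro j
    by_cases hk : j ≠ b ∧ ∃ k, k ≠ i ∧ (j : ℕ) = (if k < i then k + 1 else k : ℕ)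
    · obtain ⟨hj, k, hki, hjk⟩ := hk
      obtain ⟨φ, h1, h2⟩ := exists_weights_pairwise (hpair j hj i k (Ne.symm hki))
      refine ⟨φ, h1, fun _ k' hk' hjk' => ?_⟩
      have : k' = k := by
        rw [hjk] at hjk'
        split_ifs at hjk' <;> omega
      rwa [this]
    · obtain ⟨φ, h1⟩ := exists_weights_ne_zero (h0 j i)
      exact ⟨φ, h1, fun hj k hki hjk => absurd ⟨hj, k, hki, hjk⟩ hk⟩
  choose φ hφ1 hφ2 using hφ
  refine ⟨φ, fun j _ _ => hφ1 j, fun k hk => ?_⟩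
  have hlt : (if k < i then k + 1 else k : ℕ) + 1 < d ∧
      0 < (if k < i then k + 1 else k : ℕ) := by
    split_ifs <;> omega
  have hjb : (⟨(if k < i then k + 1 else k : ℕ), by omega⟩ : Fin d) ≠ b := fun hj => by
    have := congrArg Fin.val hj
    simp only at this
    omega
  refine ⟨⟨(if k < i then k + 1 else k : ℕ), by omega⟩, fun hj => ?_, hjb, hφ2 _ hjb k hk rfl⟩
  have := congrArg Fin.val hj
  simp only at this
  omega
end OrthCPD

/-! ### Generic uniqueness -/

theorem mainTheorem11 (d R t : ℕ) (n : Fin d → ℕ) (hd : 3 ≤ d) (hR : 2 ≤ R)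
    (hn : ∀ j, OrthCPD.NonOrth t j → 2 ≤ n j)
    (h : (t = 1 ∧ R + 1 ≤ d) ∨ (t = 2 ∧ 5 ≤ d) ∨
      ((t = 1 ∨ t = 2) ∧ ∀ j, OrthCPD.NonOrth t j → R ≤ n j))
    (μ : Measure (OrthCPD.NonOrthEntries n R t)) [IsProbabilityMeasure μ]
    (hμ : μ ≪ (volume : Measure (OrthCPD.NonOrthEntries n R t))) :
    ∀ᵐ X ∂μ, ∀ (σ : Fin R → ℝ) (U : OrthCPD.Factors n R),
      (∀ i, σ i ≠ 0) →
      (∀ (j : Fin d) (hj : OrthCPD.NonOrth t j), U j = Matrix.of (X ⟨j, hj⟩)) →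
      (∀ j, ¬ OrthCPD.NonOrth t j → (U j).transpose * U j = 1) →
      OrthCPD.IsUniqueDecomposition t σ U := by
  have ht : t = 1 ∨ t = 2 := by tauto
  have hgen : ∀ᵐ X : OrthCPD.NonOrthEntries n R t, ∀ j : {j : Fin d // OrthCPD.NonOrth t j},
      ∀ m : Fin (R + 1), ∀ (f : Fin m ↪ Fin (n j)) (g : Fin m ↪ Fin R),
        ((Matrix.of (X j)).submatrix f g).det ≠ 0 :=
    ae_all_iff.2 fun j => ae_all_iff.2 fun m => ae_all_iff.2 fun f => ae_all_iff.2 fun g =>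
      OrthCPD.ae_det_submatrix_ne_zero j f g
  filter_upwards [hμ.ae_le hgen] with X hX σ U hσ hUX hU
  -- Invertible `2 × 2` and `R × R` submatrices give pairwise and full independence of the columns.
  have hpair : ∀ j, OrthCPD.NonOrth t j → ∀ i k, i ≠ k →
      ∃ z w, U j z i * U j w k ≠ U j w i * U j z k := by
    intro j hj i k hik
    have hinj : Function.Injective ![i, k] := by
      simp [Function.Injective, Fin.forall_fin_two, hik, Ne.symm hik]
    have := hX ⟨j, hj⟩ ⟨2, by omega⟩ (Fin.castLEEmb (hn j hj)) ⟨![i, k], hinj⟩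
    rw [← hUX j hj, Matrix.det_fin_two] at this
    refine ⟨Fin.castLE (hn j hj) 0, Fin.castLE (hn j hj) 1, fun heq => this ?_⟩
    simp only [Matrix.submatrix_apply]
    exact sub_eq_zero.2 (heq.trans (mul_comm _ _))
  have h0 : ∀ j i, ∃ p, U j p i ≠ 0 := by
    intro j i
    by_contra! hall
    by_cases hj : OrthCPD.NonOrth t j
    · obtain ⟨k, hk⟩ : ∃ k : Fin R, k ≠ i := by
        have : Nontrivial (Fin R) := Fin.nontrivial_iff_two_le.2 hR
        exact exists_ne i
      obtain ⟨z, w, hzw⟩ := hpair j hj i k (Ne.symm hk)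
      exact hzw (by rw [hall, hall, zero_mul, zero_mul])
    · have := congrFun (congrFun (hU j hj) i) i
      simp [Matrix.mul_apply, hall] at this
  have hfull : ∀ j, OrthCPD.NonOrth t j → R ≤ n j →
      ∃ W : Matrix (Fin R) (Fin (n j)) ℝ, W * U j = 1 := by
    intro j hj hRn
    have := hX ⟨j, hj⟩ ⟨R, by omega⟩ (Fin.castLEEmb hRn) (Function.Embedding.refl _)
    rw [← hUX j hj] at this
    refine ⟨((U j).submatrix (Fin.castLE hRn) id)⁻¹ *
      (1 : Matrix (Fin (n j)) (Fin (n j)) ℝ).submatrix (Fin.castLE hRn) id, ?_⟩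
    have hsel : (1 : Matrix (Fin (n j)) (Fin (n j)) ℝ).submatrix (Fin.castLE hRn) id * U j =
        (U j).submatrix (Fin.castLE hRn) id := by
      ext a i
      simp [Matrix.mul_apply, Matrix.one_apply]
    rw [Matrix.mul_assoc, hsel]
    exact Matrix.nonsing_inv_mul _ (Ne.isUnit this)
  refine OrthCPD.isUniqueDecomposition_of_terms hσ h0 hU fun σ' U' heq => ?_
  let c : Fin d := ⟨0, by omega⟩
  let b : Fin d := ⟨d - 1, by omega⟩
  have hcb : c ≠ b := fun hj => by
    have : 0 = d - 1 := congrArg Fin.val hj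
    omega
  have hc : OrthCPD.NonOrth t c := show 0 + t < d by omega
  have hb : ¬ OrthCPD.NonOrth t b := show ¬ (d - 1 + t < d) by omega
  have hpos : ∀ j, NeZero (n j) := fun j => by
    obtain ⟨p, -⟩ := h0 j ⟨0, by omega⟩
    exact ⟨(Fin.pos p).ne'⟩
  have := hpos c
  have := hpos b
  refine OrthCPD.exists_perm_term_eq hσ hcb (h0 c) (hpair c hc) (hU b hb) (fun i => ?_) heq
  have hmid : ∀ l : Fin d, 0 < (l : ℕ) → (l : ℕ) < d - 1 → l ≠ c ∧ l ≠ b := fun l h1 h2 =>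
    ⟨fun hl => by rw [hl] at h1; exact lt_irrefl _ h1,
      fun hl => by rw [hl] at h2; exact lt_irrefl _ h2⟩
  -- A middle factor with independent columns: the factor `1` if `t = 1` and the factors have at least
  -- `R` rows, the orthonormal factor `d - 2` if `t = 2`.
  rcases ht with rfl | rfl
  · have hcase : R + 1 ≤ d ∨ ∀ j : Fin d, OrthCPD.NonOrth 1 j → R ≤ n j := by
      rcases h with h | h | h
      · exact Or.inl h.2
      · omega
      · exact Or.inr h.2
    rcases hcase with hRd | hRn
    · refine OrthCPD.exists_separating_weights_of_pairwise (c := c) (b := b) rfl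
        (show d - 1 + 1 = d by omega) hRd h0 (fun j hj => hpair j ?_) i
      have : (j : ℕ) ≠ d - 1 := fun hval => hj (Fin.ext hval)
      show (j : ℕ) + 1 < d
      omega
    · obtain ⟨hlc, hlb⟩ := hmid ⟨1, by omega⟩ Nat.one_pos (show 1 < d - 1 by omega)
      have hl : OrthCPD.NonOrth 1 (⟨1, by omega⟩ : Fin d) := show 1 + 1 < d by omega
      obtain ⟨W, hW⟩ := hfull _ hl (hRn _ hl)
      exact OrthCPD.exists_separating_weights_of_mul_eq_one h0 hlc hlb hW i
  · obtain ⟨hlc, hlb⟩ := hmid ⟨d - 2, by omega⟩ (show 0 < d - 2 by omega)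
      (show d - 2 < d - 1 by omega)
    exact OrthCPD.exists_separating_weights_of_mul_eq_one h0 hlc hlb
      (hU _ (show ¬ (d - 2 + 2 < d) by omega)) i
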